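/- Let $\{\varepsilon_t\}_{t\ge1}$ be i.i.d. real random variables with $E\varepsilon_1=0$ and $0<E\varepsilon_1^2<\infty$, let $Y_0$ be a random variable independent of $\{\varepsilon_t\}_{t\ge1}$ with $E Y_0^2<\infty$, and let $\alpha>1$, $\beta\le1$, $r\in\mathbb R$. For $t\ge1$ let $$Y_t=\begin{cases}\alpha Y_{t-1}+\varepsilon_t,& Y_{t-1}>r,\\ \beta Y_{t-1}+\varepsilon_t,& Y_{t-1}\le r,\end{cases}\qquad\text{and let}\qquad \hat\alpha_n=\frac{\sum_{t=1}^{n-1}I\{Y_t>r\}\,Y_tY_{t+1}}{\sum_{t=1}^{n-1}I\{Y_t>r\}\,Y_t^2}$$ be the least-squares estimator of $\alpha$ (with the convention $x/0=0$). Assume that either (H1) $r=0$, or (H2) $r\ne0$ and $P(\varepsilon_1\le x)<1$ for every $x\in\mathbb R$. Put $m_k=\sum_{t=k}^{\infty}I\{Y_t\le r\}$ for $k\ge0$. Then $m_k<\infty$ almost surely for every $k$. Define $$\xi=\sum_{k=1}^{\infty}\alpha^{-k}\Bigl(\frac{\beta}{\alpha}\Bigr)^{m_k}\varepsilon_k+\Bigl(\frac{\beta}{\alpha}\Bigr)^{m_0}Y_0\quad\text{if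 }\beta\ne0,$$ $$\xi=\sum_{k=1}^{\infty}\frac{\prod_{t=k}^{\infty}I\{Y_t>r\}}{\alpha^{k}}\,\varepsilon_k+\prod_{t=0}^{\infty}I\{Y_t>r\}\,Y_0\quad\text{if }\beta=0.$$ The series defining $\xi$ and the series $\sum_{t\ge1}\alpha^{-t}\varepsilon_t$ converge absolutely almost surely (so both sums are random variables up to null sets), $\xi>0$ almost surely, $Y_n/\alpha^n\to\xi$ almost surely, and $$(\alpha^2-1)^{-1}\alpha^n(\hat\alpha_n-\alpha)\Rightarrow\eta^*/\xi^*\qquad(n\to\infty),$$ where $\Rightarrow$ denotes convergence in distribution and $\eta^*$, $\xi^*$ are independent random variables such that $\eta^*$ has the law of $\sum_{t=1}^{\infty}\alpha^{-t}\varepsilon_t$ and $\xi^*$ has the law of $\xi$. -/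

import Mathlib

open MeasureTheory ProbabilityTheory Filter Topology

noncomputable section

/-- `Y` solves the two-regime threshold autoregression of order one with intercepts `γ`, `δ`,
slopes `α`, `β`, threshold `r` and innovations `ε 1, ε 2, …` (`ε 0` plays no role). -/
def IsTAR {Ω : Type*} (γ δ α β r : ℝ) (Y ε : ℕ → Ω → ℝ) : Prop :=
  ∀ (t : ℕ) (ω : Ω), Y (t + 1) ω =
    if r < Y t ω then γ + α * Y t ω + ε (t + 1) ω else δ + β * Y t ω + ε (t + 1) ω

/-- The least-squares estimator of the upper slope `α` computed from `Y 1, …, Y n`, when the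
intercept `γ` and the threshold `r` are known. -/
def lseAlpha {Ω : Type*} (γ r : ℝ) (Y : ℕ → Ω → ℝ) (n : ℕ) (ω : Ω) : ℝ :=
  (∑ t ∈ Finset.Ico 1 n, if r < Y t ω then Y t ω * (Y (t + 1) ω - γ) else 0) /
    (∑ t ∈ Finset.Ico 1 n, if r < Y t ω then Y t ω ^ 2 else 0)

/-- The number of times `t ≥ k` with `Y t ≤ r` (meaningful when there are finitely many). -/
def lowerVisits {Ω : Type*} (r : ℝ) (Y : ℕ → Ω → ℝ) (k : ℕ) (ω : Ω) : ℕ :=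
  {t : ℕ | k ≤ t ∧ Y t ω ≤ r}.ncard

/-- The weight `(β / α) ^ m_k`, with `m_k` the number of visits to the lower regime from time `k`
on, if `β ≠ 0`, and the infinite product of the indicators of `Y t > r`, `t ≥ k`, if `β = 0`. -/
def xiWeight {Ω : Type*} (α β r : ℝ) (Y : ℕ → Ω → ℝ) (k : ℕ) (ω : Ω) : ℝ :=
  if β = 0 then ∏' t : ℕ, (if r < Y (k + t) ω then (1 : ℝ) else 0)
  else (β / α) ^ lowerVisits r Y k ω

/-- The `k`-th term, `k ≥ 1`, of the series in the definition of `ξ`. -/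
def xiTerm {Ω : Type*} (α β r : ℝ) (Y ε : ℕ → Ω → ℝ) (k : ℕ) (ω : Ω) : ℝ :=
  xiWeight α β r Y k ω / α ^ k * ε k ω

/-- The random variable `ξ`: the series over `k ≥ 1` plus the contribution of `Y 0`. -/
def xi {Ω : Type*} (α β r : ℝ) (Y ε : ℕ → Ω → ℝ) (ω : Ω) : ℝ :=
  (∑' k : ℕ, xiTerm α β r Y ε (k + 1) ω) + xiWeight α β r Y 0 ω * Y 0 ω

/-- The random variable `∑_{t ≥ 1} α ^ (-t) ε_t`. -/
def eta {Ω : Type*} (α : ℝ) (ε : ℕ → Ω → ℝ) (ω : Ω) : ℝ :=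
  ∑' t : ℕ, ε (t + 1) ω / α ^ (t + 1)

end

/-!
Dividing the recursion by `α ^ n` turns `Y n / α ^ n` into a sum of discounted innovations, each
weighted by one factor `β / α` per later visit to the lower regime. Since the discounted innovations
are absolutely summable, everything about `ξ` reduces to one statement: almost surely `Y` ends up
above a positive multiple of `α ^ n`, and in the upper regime (`ae_exists_pow_mul_le`). This single
bound gives the finiteness of the numbers of lower visits, the limit `Y n / α ^ n → ξ`
(`tendsto_div_pow_xi`) and the strict positivity of `ξ`.

The geometric growth is obtained by repeated trials. Below `min r 0` we have `β * y ≥ y`, because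
`β ≤ 1`, so there the process dominates the random walk of its innovations; that walk is
unbounded above, by the central limit theorem and a zero-one law (`ae_forall_exists_lt_sum`). Hence
`Y` exceeds `min r 0` infinitely often. From each such time, finitely many large innovations followed
by innovations with a small discounted sum, an event of fixed positive probability independent of the
past, make the process grow geometrically for ever. Lévy's zero-one law
(`ae_mem_of_frequently_of_indep`) shows that one of these trials succeeds almost surely.

For the estimator, the normalized error is, up to a term tending to zero almost surely, the product
of the reversed sum `∑ t ∈ Ico (n / 3) n, ε (t + 1) / α ^ (n - t)` and a factor tending to `1 / ξ`
(`tendsto_normalized_error_sub`). The reversed sum is independent of the path up to time `n / 3`,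
which already determines `ξ` approximately, and it has the law of a partial sum of `η`. The pair is
therefore distributed as one on the product space `Ω × Ω` that converges almost surely to a pair of
independent copies of `η` and `1 / ξ` (`tendstoInDistribution_prodMk_reversed`), and Slutsky's
argument and the continuous mapping theorem finish the proof.
-/

/-! ### Discounted paths and the limit `ξ` -/

/-- Convolving a convergent sequence with a geometric kernel gives a convergent sequence. -/
theorem tendsto_sum_pow_sub_mul {q l : ℝ} (hq0 : 0 ≤ q) (hq1 : q < 1) {b : ℕ → ℝ}
    (hb : Tendsto b atTop (𝓝 l)) :
    Tendsto (fun n => ∑ t ∈ Finset.Ico 1 n, q ^ (n - t) * b t) atTop (𝓝 (q / (1 - q) * l)) := by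
  obtain ⟨C, hC⟩ : ∃ C, ∀ n, |b n| ≤ C := by
    obtain ⟨C, hC⟩ := (Metric.isBounded_range_of_tendsto b hb).exists_norm_le
    exact ⟨C, fun n => hC _ ⟨n, rfl⟩⟩
  have hlim : Tendsto
      (fun n => ∑' j : ℕ, if j + 1 < n then q ^ (j + 1) * b (n - (j + 1)) else 0) atTop
      (𝓝 (∑' j : ℕ, q ^ (j + 1) * l)) := by
    refine tendsto_tsum_of_dominated_convergence (bound := fun j => q ^ (j + 1) * C) ?_ ?_ ?_
    · exact ((summable_nat_add_iff 1).2 (summable_geometric_of_lt_one hq0 hq1)).mul_right C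
    · intro j
      refine (((hb.comp (tendsto_sub_atTop_nat (j + 1))).const_mul (q ^ (j + 1)))).congr' ?_
      filter_upwards [eventually_gt_atTop (j + 1)] with n hn
      simp [hn]
    · refine Eventually.of_forall fun n j => ?_
      have hC0 : 0 ≤ C := (abs_nonneg _).trans (hC 0)
      split_ifs
      · rw [Real.norm_eq_abs, abs_mul, abs_of_nonneg (by positivity : 0 ≤ q ^ (j + 1))]
        exact mul_le_mul_of_nonneg_left (hC _) (by positivity)
      · simpa using by positivity
  have hsum : ∑' j : ℕ, q ^ (j + 1) * l = q / (1 - q) * l := by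
    rw [tsum_mul_right]
    congr 1
    simp_rw [pow_succ']
    rw [tsum_mul_left, tsum_geometric_of_lt_one hq0 hq1, div_eq_mul_inv]
  rw [hsum] at hlim
  refine hlim.congr fun n => ?_
  rw [tsum_eq_sum (s := Finset.range (n - 1))]
  · refine Finset.sum_bij' (fun j _ => n - (j + 1)) (fun t _ => n - t - 1) ?_ ?_ ?_ ?_ ?_
    · intro j hj; simp only [Finset.mem_range, Finset.mem_Ico] at *; omega
    · intro t ht; simp only [Finset.mem_range, Finset.mem_Ico] at *; omega
    · intro j hj; simp only [Finset.mem_range] at *; omega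
    · intro t ht; simp only [Finset.mem_Ico] at *; omega
    · intro j hj
      simp only [Finset.mem_range] at hj
      rw [if_pos (by omega), Nat.sub_sub_self (by omega)]
  · intro j hj
    simp only [Finset.mem_range] at hj
    rw [if_neg (by omega)]

/-- A path that starts above `M` stays above a geometric sequence if the discounted innovations
sum to at most `M / 2`. -/
theorem pow_mul_half_le_of_sum_le {α β r M : ℝ} {y e : ℕ → ℝ} {N : ℕ} (hα : 1 < α)
    (hy : ∀ t, y (t + 1) = if r < y t then α * y t + e (t + 1) else β * y t + e (t + 1))
    (hM : 0 < M) (hMr : r < M / 2) (hN : M ≤ y N)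
    (he : ∀ m, ∑ j ∈ Finset.range m, |e (N + j + 1)| / α ^ (j + 1) ≤ M / 2) (m : ℕ) :
    α ^ m * (M / 2) ≤ y (N + m) := by
  have key : ∀ m, α ^ m * (M - ∑ j ∈ Finset.range m, |e (N + j + 1)| / α ^ (j + 1)) ≤
      y (N + m) := by
    intro m
    induction m with
    | zero => simpa using hN
    | succ m ih =>
      have hpow : 1 ≤ α ^ m := one_le_pow₀ hα.le
      have h1 : M / 2 ≤ y (N + m) := by nlinarith [he m]
      rw [← add_assoc, hy, if_pos (hMr.trans_le h1), Finset.sum_range_succ]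
      have h2 : α ^ (m + 1) * (|e (N + m + 1)| / α ^ (m + 1)) = |e (N + m + 1)| := by
        field_simp
      have h3 := neg_abs_le (e (N + m + 1))
      have h4 : α * (α ^ m * (M - ∑ j ∈ Finset.range m, |e (N + j + 1)| / α ^ (j + 1))) ≤
        α * y (N + m) := mul_le_mul_of_nonneg_left ih (by linarith)
      rw [pow_succ'] at h2 ⊢
      linarith
  refine le_trans ?_ (key m)
  have := he m
  gcongr
  linarith

/-- The path as a sum over its innovations, discounted by the slopes met along the way. -/
theorem path_div_pow_eq {α β r : ℝ} {y e : ℕ → ℝ} (hα : 1 < α)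
    (hy : ∀ t, y (t + 1) = if r < y t then α * y t + e (t + 1) else β * y t + e (t + 1)) (n : ℕ) :
    y n / α ^ n = (∏ t ∈ Finset.Ico 0 n, if r < y t then 1 else β / α) * y 0 +
      ∑ k ∈ Finset.range n, (∏ t ∈ Finset.Ico (k + 1) n, if r < y t then 1 else β / α) /
        α ^ (k + 1) * e (k + 1) := by
  have hα0 : α ≠ 0 := by positivity
  induction n with
  | zero => simp
  | succ n ih =>
    have hstep : y (n + 1) / α ^ (n + 1) =
        (if r < y n then 1 else β / α) * (y n / α ^ n) + e (n + 1) / α ^ (n + 1) := by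
      rw [hy]
      split_ifs <;> field_simp <;> ring
    rw [hstep, ih, Finset.sum_range_succ, Finset.prod_Ico_succ_top (Nat.zero_le n), mul_add,
      Finset.mul_sum, add_assoc]
    congr 1
    · ring
    · congr 1
      · refine Finset.sum_congr rfl fun k hk => ?_
        rw [Finset.prod_Ico_succ_top (Finset.mem_range.1 hk)]
        ring
      · simp; ring

/-- The weight of `ξ` is a finite product along a path that is in the upper regime from time `N` on.
For `β = 0` the factor `β / α = 0` reproduces the product of indicators. -/
theorem xiWeight_eq_prod {Ω : Type*} {α β r : ℝ} {Y : ℕ → Ω → ℝ} {ω : Ω} {N : ℕ}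
    (hN : ∀ t, N ≤ t → r < Y t ω) {k n : ℕ} (hn : N ≤ n) :
    xiWeight α β r Y k ω = ∏ t ∈ Finset.Ico k n, if r < Y t ω then 1 else β / α := by
  unfold xiWeight
  split_ifs with hβ
  · subst hβ
    rw [tprod_eq_prod (s := Finset.range (n - k)), Finset.prod_Ico_eq_prod_range]
    · simp
    · intro t ht
      simp only [Finset.mem_range] at ht
      rw [if_pos (hN _ (by omega))]
  · rw [Finset.prod_ite, Finset.prod_const_one, one_mul, Finset.prod_const, lowerVisits,
      ← Set.ncard_coe_finset]
    congr 2
    ext t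
    simp only [Set.mem_ofPred_eq, Finset.coe_filter, Finset.mem_Ico, not_lt]
    constructor
    · rintro ⟨h1, h2⟩
      refine ⟨⟨h1, ?_⟩, h2⟩
      by_contra! h
      exact absurd (hN t (hn.trans h)) (not_lt.2 h2)
    · rintro ⟨⟨h1, -⟩, h2⟩
      exact ⟨h1, h2⟩

theorem finite_lower_visits {Ω : Type*} {r : ℝ} {Y : ℕ → Ω → ℝ} {ω : Ω} {N : ℕ}
    (hN : ∀ t, N ≤ t → r < Y t ω) (k : ℕ) : {t : ℕ | k ≤ t ∧ Y t ω ≤ r}.Finite := by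
  refine (Set.finite_lt_nat N).subset fun t ht => ?_
  by_contra h
  exact absurd (hN t (not_lt.1 h)) (not_lt.2 ht.2)

theorem summable_xiTerm {Ω : Type*} {α β r : ℝ} {Y ε : ℕ → Ω → ℝ} {ω : Ω} {N : ℕ}
    (hN : ∀ t, N ≤ t → r < Y t ω)
    (hs : Summable fun t : ℕ => ε (t + 1) ω / α ^ (t + 1)) :
    Summable fun k : ℕ => xiTerm α β r Y ε (k + 1) ω := by
  rw [← summable_nat_add_iff N] at hs ⊢
  refine hs.congr fun k => ?_
  rw [xiTerm, xiWeight_eq_prod hN (n := k + N + 1) (by omega)]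
  simp
  ring

/-- A path that eventually stays in the upper regime satisfies `Y n / α ^ n → ξ`. -/
theorem tendsto_div_pow_xi {Ω : Type*} {α β r : ℝ} {Y ε : ℕ → Ω → ℝ} {ω : Ω} {N : ℕ}
    (hα : 1 < α)
    (hy : ∀ t, Y (t + 1) ω =
      if r < Y t ω then α * Y t ω + ε (t + 1) ω else β * Y t ω + ε (t + 1) ω)
    (hN : ∀ t, N ≤ t → r < Y t ω)
    (hs : Summable fun t : ℕ => ε (t + 1) ω / α ^ (t + 1)) :
    Tendsto (fun n : ℕ => Y n ω / α ^ n) atTop (𝓝 (xi α β r Y ε ω)) := by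
  refine ((summable_xiTerm (β := β) hN hs).hasSum.tendsto_sum_nat.add_const
    (xiWeight α β r Y 0 ω * Y 0 ω)).congr' ?_
  filter_upwards [eventually_ge_atTop N] with n hn
  rw [path_div_pow_eq (y := fun t => Y t ω) (e := fun t => ε t ω) hα hy n, add_comm,
    xiWeight_eq_prod hN hn]
  congr 1
  refine Finset.sum_congr rfl fun k _ => ?_
  rw [xiTerm, xiWeight_eq_prod hN hn]

/-! ### Asymptotics of the estimation error along a path -/

section
variable {Ω : Type*} {α r L : ℝ} {Y ε : ℕ → Ω → ℝ} {ω : Ω} {N : ℕ}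

/-- The squares accumulate geometrically, so their normalized sum converges. -/
theorem tendsto_sum_sq_div_pow (hα : 1 < α) (hN : ∀ t, N ≤ t → r < Y t ω)
    (hL : Tendsto (fun n => Y n ω / α ^ n) atTop (𝓝 L)) :
    Tendsto (fun n => (∑ t ∈ Finset.Ico 1 n, if r < Y t ω then Y t ω ^ 2 else 0) / α ^ (2 * n))
      atTop (𝓝 (L ^ 2 / (α ^ 2 - 1))) := by
  have hα2 : 1 < α ^ 2 := one_lt_pow₀ hα two_ne_zero
  have hb : Tendsto (fun t => if r < Y t ω then (Y t ω / α ^ t) ^ 2 else 0) atTop (𝓝 (L ^ 2)) := by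
    refine (hL.pow 2).congr' ?_
    filter_upwards [eventually_ge_atTop N] with t ht
    rw [if_pos (hN t ht)]
  have h := tendsto_sum_pow_sub_mul (q := (α ^ 2)⁻¹) (by positivity) (inv_lt_one_of_one_lt₀ hα2) hb
  have hlim : (α ^ 2)⁻¹ / (1 - (α ^ 2)⁻¹) * L ^ 2 = L ^ 2 / (α ^ 2 - 1) := by
    have : α ^ 2 - 1 ≠ 0 := by linarith
    have : 1 - (α ^ 2)⁻¹ ≠ 0 := by
      have := inv_lt_one_of_one_lt₀ hα2
      linarith
    field_simp
  rw [hlim] at h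
  refine h.congr fun n => ?_
  rw [Finset.sum_div]
  refine Finset.sum_congr rfl fun t ht => ?_
  split_ifs
  · have : α ^ (2 * n) = (α ^ 2) ^ (n - t) * (α ^ t) ^ 2 := by
      rw [← pow_mul, ← pow_mul, ← pow_add]
      congr 1
      have := (Finset.mem_Ico.1 ht).2
      omega
    rw [this, div_pow, inv_pow]
    field_simp
  · simp

/-- The error `Y t / α ^ t - L` is the tail of a series of innovations, and is so small that it
beats the growth of the innovations. -/
theorem tendsto_sub_mul_innovation (hα : 1 < α)
    (hy : ∀ t, N ≤ t → Y (t + 1) ω = α * Y t ω + ε (t + 1) ω)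
    (hL : Tendsto (fun n => Y n ω / α ^ n) atTop (𝓝 L))
    (hs : Summable fun t : ℕ => |ε (t + 1) ω| / √α ^ (t + 1)) :
    Tendsto (fun t => (Y t ω / α ^ t - L) * ε (t + 1) ω) atTop (𝓝 0) := by
  have hα0 : 0 < α := by positivity
  -- writing `α = ρ * ρ`, one factor `ρ` in `|Y t / α ^ t - L|` absorbs the growth of `ε (t + 1)`
  set ρ := √α with hρ
  have hρ1 : 1 < ρ := by rw [hρ]; exact Real.lt_sqrt_of_sq_lt (by simpa using hα)
  have hρα : α = ρ * ρ := (Real.mul_self_sqrt hα0.le).symm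
  have htail : Tendsto (fun t => ∑' m, |ε (m + t + 1) ω| / ρ ^ (m + t + 1)) atTop (𝓝 0) :=
    tendsto_sum_nat_add fun t => |ε (t + 1) ω| / ρ ^ (t + 1)
  refine squeeze_zero_norm' ?_ ((zero_mul (0 : ℝ)) ▸ htail.mul hs.tendsto_atTop_zero)
  filter_upwards [eventually_ge_atTop N] with t ht
  have hst := (summable_nat_add_iff t).2 hs
  have hle : ∀ m, |ε (t + m + 1) ω| / α ^ (t + m + 1) ≤
      (ρ ^ (t + 1))⁻¹ * (|ε (m + t + 1) ω| / ρ ^ (m + t + 1)) := by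
    intro m
    rw [hρα, mul_pow, add_comm t m, div_mul_eq_div_div, inv_mul_eq_div]
    gcongr
    · exact hρ1.le
    · omega
  have hdist : dist (Y t ω / α ^ t) L ≤
      ∑' m, (ρ ^ (t + 1))⁻¹ * (|ε (m + t + 1) ω| / ρ ^ (m + t + 1)) := by
    refine dist_le_tsum_of_dist_le_of_tendsto₀ (f := fun m => Y (t + m) ω / α ^ (t + m)) _ ?_
      (hst.mul_left _) ?_
    · intro m
      refine le_trans (le_of_eq ?_) (hle m)
      have hstep : Y (t + m.succ) ω / α ^ (t + m.succ) =
          Y (t + m) ω / α ^ (t + m) + ε (t + m + 1) ω / α ^ (t + m + 1) := by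
        rw [Nat.succ_eq_add_one, ← add_assoc, hy _ (by omega), add_div, pow_succ']
        field_simp
      rw [hstep, dist_self_add_right, Real.norm_eq_abs, abs_div, abs_of_pos (a := α ^ _)]
      positivity
    · simpa only [Function.comp_def, add_comm] using hL.comp (tendsto_add_atTop_nat t)
  rw [tsum_mul_left, Real.dist_eq] at hdist
  rw [Real.norm_eq_abs, abs_mul]
  calc |Y t ω / α ^ t - L| * |ε (t + 1) ω|
      ≤ ((ρ ^ (t + 1))⁻¹ * ∑' m, |ε (m + t + 1) ω| / ρ ^ (m + t + 1)) * |ε (t + 1) ω| := by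
        gcongr
    _ = _ := by ring

/-- The innovations up to time `n / 3` are negligible in the reversed discounted sum. -/
theorem tendsto_sum_Ico_div_three (hα : 1 < α)
    (hs : Summable fun t : ℕ => |ε (t + 1) ω| / α ^ (t + 1)) :
    Tendsto (fun n : ℕ => ∑ t ∈ Finset.Ico 1 n, ε (t + 1) ω / α ^ (n - t) -
      ∑ t ∈ Finset.Ico (n / 3) n, ε (t + 1) ω / α ^ (n - t)) atTop (𝓝 0) := by
  have hdiv : Tendsto (fun n : ℕ => n / 3) atTop atTop :=
    Nat.tendsto_div_const_atTop (by norm_num)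
  have hgeo : Tendsto (fun n : ℕ => (α ^ (n / 3))⁻¹ * ∑' t : ℕ, |ε (t + 1) ω| / α ^ (t + 1)) atTop
      (𝓝 0) := by
    rw [← zero_mul (∑' t : ℕ, |ε (t + 1) ω| / α ^ (t + 1))]
    exact (tendsto_inv_atTop_zero.comp
      ((tendsto_pow_atTop_atTop_of_one_lt hα).comp hdiv)).mul_const _
  refine squeeze_zero_norm' ?_ hgeo
  filter_upwards [eventually_ge_atTop 3] with n hn
  rw [← Finset.sum_Ico_consecutive _ (by omega : 1 ≤ n / 3) (by omega : n / 3 ≤ n),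
    add_sub_cancel_right]
  calc ‖∑ t ∈ Finset.Ico 1 (n / 3), ε (t + 1) ω / α ^ (n - t)‖
      ≤ ∑ t ∈ Finset.Ico 1 (n / 3), (α ^ (n / 3))⁻¹ * (|ε (t + 1) ω| / α ^ (t + 1)) := by
        refine norm_sum_le_of_le _ fun t ht => ?_
        have ht := Finset.mem_Ico.1 ht
        rw [Real.norm_eq_abs, abs_div, abs_of_pos (by positivity : 0 < α ^ (n - t)),
          inv_mul_eq_div, div_div, ← pow_add]
        gcongr
        · exact hα.le
        · omega
    _ ≤ _ := by
        rw [← Finset.mul_sum]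
        gcongr
        exact hs.sum_le_tsum _ fun t _ => by positivity

/-- The normalized numerator of the estimation error is asymptotic to `L` times the reversed
discounted sum of the innovations after time `n / 3`. -/
theorem tendsto_sum_mul_innovation_sub (hα : 1 < α)
    (hy : ∀ t, N ≤ t → Y (t + 1) ω = α * Y t ω + ε (t + 1) ω)
    (hN : ∀ t, N ≤ t → r < Y t ω)
    (hL : Tendsto (fun n => Y n ω / α ^ n) atTop (𝓝 L))
    (hs : Summable fun t : ℕ => |ε (t + 1) ω| / √α ^ (t + 1))
    (hs' : Summable fun t : ℕ => |ε (t + 1) ω| / α ^ (t + 1)) :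
    Tendsto (fun n : ℕ => (∑ t ∈ Finset.Ico 1 n, if r < Y t ω then Y t ω * ε (t + 1) ω else 0) /
      α ^ n - L * ∑ t ∈ Finset.Ico (n / 3) n, ε (t + 1) ω / α ^ (n - t)) atTop (𝓝 0) := by
  have hb : Tendsto (fun t => (if r < Y t ω then Y t ω / α ^ t * ε (t + 1) ω else 0) -
      L * ε (t + 1) ω) atTop (𝓝 0) := by
    refine (tendsto_sub_mul_innovation hα hy hL hs).congr' ?_
    filter_upwards [eventually_ge_atTop N] with t ht
    rw [if_pos (hN t ht)]
    ring
  have h1 := tendsto_sum_pow_sub_mul (q := α⁻¹) (by positivity) (inv_lt_one_of_one_lt₀ hα) hb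
  have h2 := (tendsto_sum_Ico_div_three hα hs').const_mul L
  have h := h1.add h2
  simp only [mul_zero, add_zero] at h
  refine h.congr fun n => ?_
  rw [mul_sub, ← add_sub_assoc]
  congr 1
  rw [Finset.mul_sum, Finset.sum_div, ← Finset.sum_add_distrib]
  refine Finset.sum_congr rfl fun t ht => ?_
  have hpow : α ^ n = α ^ (n - t) * α ^ t := by
    rw [← pow_add, Nat.sub_add_cancel (Finset.mem_Ico.1 ht).2.le]
  split_ifs
  · rw [hpow, inv_pow]
    field_simp
    ring
  · rw [inv_pow]
    field_simp
    ring

theorem lseAlpha_sub {n : ℕ} (hy : ∀ t, r < Y t ω → Y (t + 1) ω = α * Y t ω + ε (t + 1) ω)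
    (hV : (∑ t ∈ Finset.Ico 1 n, if r < Y t ω then Y t ω ^ 2 else 0) ≠ 0) :
    lseAlpha 0 r Y n ω - α =
      (∑ t ∈ Finset.Ico 1 n, if r < Y t ω then Y t ω * ε (t + 1) ω else 0) /
        ∑ t ∈ Finset.Ico 1 n, if r < Y t ω then Y t ω ^ 2 else 0 := by
  rw [lseAlpha, eq_div_iff hV, sub_mul, div_mul_cancel₀ _ hV, Finset.mul_sum,
    ← Finset.sum_sub_distrib]
  refine Finset.sum_congr rfl fun t _ => ?_
  split_ifs with h
  · rw [hy t h]
    ring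
  · ring

/-- The random factor, converging to `1 / L`, by which the reversed discounted sum of innovations
is multiplied in the normalized estimation error. -/
noncomputable def errorFactor (α r L : ℝ) (Y : ℕ → Ω → ℝ) (n : ℕ) (ω : Ω) : ℝ :=
  L / ((α ^ 2 - 1) *
    ((∑ t ∈ Finset.Ico 1 n, if r < Y t ω then Y t ω ^ 2 else 0) / α ^ (2 * n)))

theorem tendsto_errorFactor (hα : 1 < α) (hN : ∀ t, N ≤ t → r < Y t ω) (hL0 : 0 < L)
    (hL : Tendsto (fun n => Y n ω / α ^ n) atTop (𝓝 L)) :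
    Tendsto (fun n => errorFactor α r L Y n ω) atTop (𝓝 L⁻¹) := by
  have hα2 : α ^ 2 - 1 ≠ 0 := by nlinarith
  have h := (tendsto_sum_sq_div_pow hα hN hL).const_mul (α ^ 2 - 1)
  rw [mul_div_cancel₀ _ hα2] at h
  have h' := (tendsto_const_nhds (x := L)).div h (by positivity)
  have : L / L ^ 2 = L⁻¹ := by field_simp
  rwa [this] at h'

/-- Along a path, the normalized estimation error is asymptotic to the reversed discounted sum times
`errorFactor`. -/
theorem tendsto_normalized_error_sub (hα : 1 < α)
    (hy : ∀ t, r < Y t ω → Y (t + 1) ω = α * Y t ω + ε (t + 1) ω)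
    (hN : ∀ t, N ≤ t → r < Y t ω) (hL0 : 0 < L)
    (hL : Tendsto (fun n => Y n ω / α ^ n) atTop (𝓝 L))
    (hs : Summable fun t : ℕ => |ε (t + 1) ω| / √α ^ (t + 1))
    (hs' : Summable fun t : ℕ => |ε (t + 1) ω| / α ^ (t + 1)) :
    Tendsto (fun n : ℕ => (α ^ 2 - 1)⁻¹ * α ^ n * (lseAlpha 0 r Y n ω - α) -
      (∑ t ∈ Finset.Ico (n / 3) n, ε (t + 1) ω / α ^ (n - t)) * errorFactor α r L Y n ω)
      atTop (𝓝 0) := by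
  have hα2 : 0 < α ^ 2 - 1 := by nlinarith
  have hV := tendsto_sum_sq_div_pow hα hN hL
  have hS := tendsto_sum_mul_innovation_sub hα (fun t ht => hy t (hN t ht)) hN hL hs hs'
  have h := (hS.div hV (by positivity)).const_mul (α ^ 2 - 1)⁻¹
  rw [zero_div, mul_zero] at h
  refine h.congr' ?_
  filter_upwards [hV.eventually_ne (by positivity : L ^ 2 / (α ^ 2 - 1) ≠ 0)] with n hn
  have hn' : (∑ t ∈ Finset.Ico 1 n, if r < Y t ω then Y t ω ^ 2 else 0) ≠ 0 := by
    intro h0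
    simp [h0] at hn
  rw [lseAlpha_sub hy hn', errorFactor]
  simp only [Pi.div_apply, two_mul, pow_add]
  field_simp

end

/-! ### Trials, random walks and discounted innovations -/

section Trials
variable {Ω : Type*} {mΩ : MeasurableSpace Ω} {P : Measure Ω}

/-- Repeated trials: if `A` follows from `E n` together with an event `G n` that is independent of the
past up to time `n` and has probability at least `δ > 0`, then `A` holds almost surely whenever
infinitely many `E n` occur. Indeed `P(A | ℱ n) ≥ δ` on `E n`, while `P(A | ℱ n)` converges to the
indicator of `A` by Lévy's upward theorem. -/
theorem ae_mem_of_frequently_of_indep [IsProbabilityMeasure P] {ℱ : Filtration ℕ mΩ} {A : Set Ω}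
    (hA : MeasurableSet[⨆ n, ℱ n] A) {E G : ℕ → Set Ω} {m : ℕ → MeasurableSpace Ω}
    (hm : ∀ n, m n ≤ mΩ) (hE : ∀ n, MeasurableSet[ℱ n] (E n))
    (hG : ∀ n, MeasurableSet[m n] (G n)) (hind : ∀ n, Indep (m n) (ℱ n) P) {δ : ℝ} (hδ : 0 < δ)
    (hδG : ∀ n, δ ≤ P.real (G n)) (hsub : ∀ n, E n ∩ G n ⊆ A) :
    ∀ᵐ ω ∂P, (∃ᶠ n in atTop, ω ∈ E n) → ω ∈ A := by
  have hle : ⨆ n, ℱ n ≤ mΩ := iSup_le ℱ.le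
  have hAm : MeasurableSet A := hle A hA
  have hlim := Integrable.tendsto_ae_condExp (μ := P) (ℱ := ℱ)
    (g := A.indicator fun _ => (1 : ℝ)) ((integrable_const 1).indicator hAm)
    (stronglyMeasurable_const.indicator hA)
  have hbound : ∀ᵐ ω ∂P, ∀ n, ω ∈ E n → δ ≤ (P[A.indicator fun _ => (1 : ℝ) | ℱ n]) ω := by
    rw [ae_all_iff]
    intro n
    have hGm : MeasurableSet (G n) := hm n _ (hG n)
    have hGi : Integrable ((G n).indicator fun _ => (1 : ℝ)) P :=
      (integrable_const 1).indicator hGm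
    have h1 := condExp_indicator (m := ℱ n) hGi (hE n)
    have h2 : P[(G n).indicator fun _ => (1 : ℝ) | ℱ n] =ᵐ[P] _ :=
      condExp_indep_eq (hm n) (ℱ.le n) (stronglyMeasurable_const.indicator (hG n)) (hind n)
    have h3 : P[(E n).indicator ((G n).indicator fun _ => (1 : ℝ)) | ℱ n] ≤ᵐ[P]
        P[A.indicator fun _ => (1 : ℝ) | ℱ n] := by
      refine condExp_mono (hGi.indicator (ℱ.le n _ (hE n)))
        ((integrable_const 1).indicator hAm) (Eventually.of_forall fun ω => ?_)
      rw [Set.indicator_indicator]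
      exact Set.indicator_le_indicator_of_subset (hsub n) (fun _ => zero_le_one) ω
    filter_upwards [h1, h2, h3] with ω h1 h2 h3 hω
    refine le_trans ?_ h3
    rw [h1, Set.indicator_of_mem hω, h2, integral_indicator_const _ hGm, smul_eq_mul, mul_one]
    exact hδG n
  filter_upwards [hlim, hbound] with ω h1 h2 h3
  by_contra hω
  rw [Set.indicator_of_notMem hω] at h1
  obtain ⟨n, hn, hn'⟩ := (h3.and_eventually (h1.eventually_lt_const hδ)).exists
  exact absurd (h2 n hn) (not_le.2 hn')

variable {X : ℕ → Ω → ℝ}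

/-- The σ-algebra generated by the `X i` with `i > n`. -/
abbrev futureSigma (X : ℕ → Ω → ℝ) (n : ℕ) : MeasurableSpace Ω :=
  ⨆ i ∈ Set.Ioi n, MeasurableSpace.comap (X i) inferInstance

theorem futureSigma_le (hX : ∀ n, Measurable (X n)) (n : ℕ) : futureSigma X n ≤ mΩ :=
  iSup₂_le fun i _ => (hX i).comap_le

theorem measurable_futureSigma {n i : ℕ} (hi : n < i) : Measurable[futureSigma X n] (X i) :=
  Measurable.of_comap_le (le_iSup₂_of_le i hi le_rfl)

/-- The natural filtration of a sequence of real random variables. -/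
def pastFiltration (X : ℕ → Ω → ℝ) (hX : ∀ n, Measurable (X n)) : Filtration ℕ mΩ :=
  Filtration.natural X fun n => (hX n).stronglyMeasurable

theorem measurable_pastFiltration (hX : ∀ n, Measurable (X n)) {n i : ℕ} (hi : i ≤ n) :
    Measurable[pastFiltration X hX n] (X i) :=
  Measurable.of_comap_le (le_iSup₂_of_le (f := fun j (_ : j ≤ n) =>
    MeasurableSpace.comap (X j) inferInstance) i hi le_rfl)

theorem indep_future_past (hX : ∀ n, Measurable (X n)) (hind : iIndepFun X P) (n : ℕ) :
    Indep (futureSigma X n) (pastFiltration X hX n) P :=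
  indep_iSup_of_disjoint (fun i => (hX i).comap_le) hind (S := Set.Ioi n) (T := {i | i ≤ n})
    (Set.disjoint_left.2 fun _ h1 h2 => absurd (Set.mem_Ioi.1 h1) (not_lt.2 h2))

theorem measurable_shift_futureSigma (n : ℕ) :
    Measurable[futureSigma X n] fun ω (t : ℕ) => X (n + t + 1) ω :=
  @measurable_pi_lambda _ _ _ (futureSigma X n) _ _ fun t =>
    measurable_futureSigma (by omega)

theorem identDistrib_shift (hind : iIndepFun X P)
    (hid : ∀ t, IdentDistrib (X (t + 1)) (X 1) P P) (n : ℕ) :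
    IdentDistrib (fun ω (t : ℕ) => X (n + t + 1) ω) (fun ω (t : ℕ) => X (t + 1) ω) P P :=
  IdentDistrib.pi (fun t => (hid (n + t)).trans (hid t).symm)
    (hind.precomp (g := fun t => n + t + 1) fun a b h => by simpa using h)
    (hind.precomp (g := fun t => t + 1) fun a b h => by simpa using h)

/-- If each visit to `E n` offers a trial on the innovations after time `n`, whose success implies
`A`, then infinitely many visits force `A`. The trials are stationary, so that a positive
success probability for one of them is enough. -/
theorem ae_mem_of_frequently_of_shift [IsProbabilityMeasure P]
    (hX : ∀ n, Measurable (X n)) (hind : iIndepFun X P)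
    (hid : ∀ t, IdentDistrib (X (t + 1)) (X 1) P P) {Γ : Set (ℕ → ℝ)} (hΓ : MeasurableSet Γ)
    (hpos : P {ω | (fun t => X (t + 1) ω) ∈ Γ} ≠ 0) {A : Set Ω}
    (hA : MeasurableSet[⨆ n, pastFiltration X hX n] A) {E : ℕ → Set Ω}
    (hE : ∀ n, MeasurableSet[pastFiltration X hX n] (E n))
    (hsub : ∀ n, ∀ ω ∈ E n, (fun t => X (n + t + 1) ω) ∈ Γ → ω ∈ A) :
    ∀ᵐ ω ∂P, (∃ᶠ n in atTop, ω ∈ E n) → ω ∈ A := by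
  refine ae_mem_of_frequently_of_indep hA (futureSigma_le hX) hE
    (fun n => measurable_shift_futureSigma n hΓ) (indep_future_past hX hind)
    (δ := P.real {ω | (fun t => X (t + 1) ω) ∈ Γ})
    (by simp [measureReal_def, ENNReal.toReal_pos_iff, pos_iff_ne_zero, hpos]) (fun n => ?_)
    (fun n ω hω => hsub n ω hω.1 hω.2)
  have := (identDistrib_shift hind hid n).measure_mem_eq hΓ
  rw [measureReal_def, measureReal_def, this]
  rfl

end Trials

section RandomWalk
variable {Ω : Type*} {mΩ : MeasurableSpace Ω} {P : Measure Ω} [IsProbabilityMeasure P]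
  {X : ℕ → Ω → ℝ}

/-- By the central limit theorem, the probability that the walk exceeds a level is bounded below,
uniformly in the level. -/
theorem exists_pos_le_measure_exists_lt_sum (hind : iIndepFun X P)
    (hid : ∀ t, IdentDistrib (X t) (X 0) P P) (hsq : MemLp (X 0) 2 P)
    (hmean : ∫ ω, X 0 ω ∂P = 0) (hvar : 0 < variance (X 0) P) :
    ∃ q : ENNReal, q ≠ 0 ∧ ∀ C : ℝ, q ≤ P {ω | ∃ n, C < ∑ k ∈ Finset.range n, X k ω} := by
  set v := (variance (X 0) P).toNNReal with hv
  have hv0 : v ≠ 0 := by rw [hv]; simpa using hvar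
  have hclt := tendstoInDistribution_inv_sqrt_mul_sum_sub (P' := gaussianReal 0 v) (Y := id)
    ⟨aemeasurable_id, Measure.map_id⟩ hsq hind hid
  refine ⟨gaussianReal 0 v (Set.Ioi 1), ?_, fun C => ?_⟩
  · intro h0
    simpa using gaussianReal_absolutelyContinuous' 0 hv0 h0
  · have h := ProbabilityMeasure.le_liminf_measure_open_of_tendsto hclt.tendsto
      (isOpen_Ioi (a := (1 : ℝ)))
    simp only [ProbabilityMeasure.coe_mk, Measure.map_id] at h
    refine h.trans (liminf_le_of_frequently_le' (Eventually.frequently ?_))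
    have hsqrt : Tendsto (fun n : ℕ => √(n : ℝ)) atTop atTop :=
      Real.tendsto_sqrt_atTop.comp tendsto_natCast_atTop_atTop
    filter_upwards [hsqrt.eventually_ge_atTop C, eventually_gt_atTop 0] with n hn hn0
    rw [Measure.map_apply_of_aemeasurable (hclt.forall_aemeasurable n) measurableSet_Ioi]
    refine measure_mono fun ω hω => ⟨n, hn.trans_lt ?_⟩
    have hpos : 0 < √(n : ℝ) := Real.sqrt_pos.2 (by exact_mod_cast hn0)
    simp only [Set.mem_preimage, Set.mem_Ioi, hmean, mul_zero, sub_zero] at hω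
    rwa [inv_mul_eq_div, one_lt_div hpos] at hω

/-- A centred square-integrable random walk that is not constant is almost surely unbounded above,
from every starting time. -/
theorem ae_forall_exists_lt_sum (hX : ∀ n, Measurable (X n)) (hind : iIndepFun X P)
    (hid : ∀ t, IdentDistrib (X (t + 1)) (X 1) P P) (hsq : MemLp (X 1) 2 P)
    (hmean : ∫ ω, X 1 ω ∂P = 0) (hvar : 0 < variance (X 1) P) :
    ∀ᵐ ω ∂P, ∀ (N : ℕ) (C : ℝ), ∃ n, C < ∑ k ∈ Finset.range n, X (N + k + 1) ω := by
  set Γ : Set (ℕ → ℝ) := ⋂ C : ℕ, {x | ∃ n, (C : ℝ) < ∑ k ∈ Finset.range n, x k} with hΓ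
  have hΓC : ∀ C : ℝ, MeasurableSet {x : ℕ → ℝ | ∃ n, C < ∑ k ∈ Finset.range n, x k} := by
    intro C
    rw [Set.ofPred_exists]
    exact MeasurableSet.iUnion fun n => measurableSet_lt measurable_const (by fun_prop)
  have hΓm : MeasurableSet Γ := MeasurableSet.iInter fun C => hΓC C
  have hXs : Measurable fun ω (t : ℕ) => X (t + 1) ω := by fun_prop
  have hpos : P {ω | (fun t => X (t + 1) ω) ∈ Γ} ≠ 0 := by
    obtain ⟨q, hq0, hq⟩ := exists_pos_le_measure_exists_lt_sum (X := fun t => X (t + 1))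
      (hind.precomp (g := fun t => t + 1) fun a b h => by simpa using h) hid hsq hmean hvar
    refine (lt_of_lt_of_le (pos_iff_ne_zero.2 hq0) ?_).ne'
    have hpre : {ω | (fun t => X (t + 1) ω) ∈ Γ} =
        ⋂ C : ℕ, {ω | ∃ n, (C : ℝ) < ∑ k ∈ Finset.range n, X (k + 1) ω} := by
      ext ω
      simp [hΓ]
    rw [hpre]
    refine ge_of_tendsto' (tendsto_measure_iInter_atTop (fun C => (hXs (hΓC C)).nullMeasurableSet)
      (fun C D hCD ω ⟨n, hn⟩ => ⟨n, lt_of_le_of_lt (by exact_mod_cast hCD) hn⟩)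
      ⟨0, measure_ne_top _ _⟩) fun C => hq C
  have hlaw : ∀ N : ℕ, ∀ᵐ ω ∂P, (fun t => X (N + t + 1) ω) ∈ Γ := by
    have h0 : ∀ᵐ ω ∂P, (fun t => X (t + 1) ω) ∈ Γ := by
      have hle : ∀ i, Measurable[⨆ n, pastFiltration X hX n] (X i) := fun i =>
        (measurable_pastFiltration hX le_rfl).mono
          (le_iSup (fun n => (pastFiltration X hX n : MeasurableSpace Ω)) i) le_rfl
      have hXs' : Measurable[⨆ n, pastFiltration X hX n] fun ω (t : ℕ) => X (t + 1) ω :=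
        @measurable_pi_lambda _ _ _ (⨆ n, (pastFiltration X hX n : MeasurableSpace Ω)) _ _
          fun t => hle (t + 1)
      have h := ae_mem_of_frequently_of_shift hX hind hid hΓm hpos
        (A := {ω | (fun t => X (t + 1) ω) ∈ Γ}) (E := fun _ => Set.univ)
        (hXs' hΓm)
        (fun n => MeasurableSet.univ) ?_
      · filter_upwards [h] with ω hω
        exact hω (Eventually.frequently (by simp))
      · -- finitely many steps do not matter for being unbounded above
        intro n ω _ hω
        simp only [hΓ, Set.mem_iInter, Set.mem_ofPred_eq] at hω ⊢
        intro C
        obtain ⟨D, hD⟩ := exists_nat_gt (C - ∑ k ∈ Finset.range n, X (k + 1) ω)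
        obtain ⟨m, hm⟩ := hω D
        refine ⟨n + m, ?_⟩
        rw [Finset.sum_range_add]
        linarith
    intro N
    exact (identDistrib_shift hind hid N).symm.ae_snd hΓm h0
  filter_upwards [ae_all_iff.2 hlaw] with ω hω N C
  obtain ⟨D, hD⟩ := exists_nat_gt C
  have := hω N
  simp only [hΓ, Set.mem_iInter, Set.mem_ofPred_eq] at this
  obtain ⟨n, hn⟩ := this D
  exact ⟨n, hD.trans hn⟩

end RandomWalk

section Summability
variable {Ω : Type*} {mΩ : MeasurableSpace Ω} {P : Measure Ω}

/-- Identically distributed integrable innovations grow slower than every geometric sequence. -/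
theorem ae_summable_abs_div_pow {ε : ℕ → Ω → ℝ}
    (hid : ∀ t, IdentDistrib (ε (t + 1)) (ε 1) P P) (hint : Integrable (ε 1) P) {ρ : ℝ}
    (hρ : 1 < ρ) : ∀ᵐ ω ∂P, Summable fun t : ℕ => |ε (t + 1) ω| / ρ ^ (t + 1) := by
  have hρ0 : 0 < ρ := by positivity
  have hmeas : ∀ t, AEMeasurable (fun ω => ENNReal.ofReal (|ε (t + 1) ω| / ρ ^ (t + 1))) P :=
    fun t => (((hid t).aemeasurable_fst.abs).div_const _).ennreal_ofReal
  have hterm : ∀ t, ∫⁻ ω, ENNReal.ofReal (|ε (t + 1) ω| / ρ ^ (t + 1)) ∂P =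
      ENNReal.ofReal ((∫ ω, |ε 1 ω| ∂P) * (ρ⁻¹) ^ (t + 1)) := by
    intro t
    have hi : Integrable (ε (t + 1)) P := (hid t).symm.integrable_snd hint
    rw [← ofReal_integral_eq_lintegral_ofReal (hi.abs.div_const _)
      (Eventually.of_forall fun ω => by positivity), integral_div, inv_pow, ← div_eq_mul_inv]
    congr 2
    exact ((hid t).comp (u := fun x => |x|) (by fun_prop)).integral_eq
  have hfin : ∫⁻ ω, ∑' t, ENNReal.ofReal (|ε (t + 1) ω| / ρ ^ (t + 1)) ∂P ≠ ⊤ := by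
    rw [lintegral_tsum hmeas]
    simp_rw [hterm]
    have hs : Summable fun t : ℕ => (∫ ω, |ε 1 ω| ∂P) * (ρ⁻¹) ^ (t + 1) :=
      ((summable_nat_add_iff 1).2 (summable_geometric_of_lt_one (by positivity)
        (inv_lt_one_of_one_lt₀ hρ))).mul_left _
    rw [← ENNReal.ofReal_tsum_of_nonneg (fun t => by positivity) hs]
    exact ENNReal.ofReal_ne_top
  filter_upwards [ae_lt_top' (AEMeasurable.tsum hmeas) hfin] with ω hω
  refine (ENNReal.summable_toReal hω.ne).congr fun t => ?_
  rw [ENNReal.toReal_ofReal (by positivity)]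

end Summability

/-! ### Geometric growth of the process -/

section Escape
variable {Ω : Type*} {mΩ : MeasurableSpace Ω} {P : Measure Ω} {X Y : ℕ → Ω → ℝ} {α β r : ℝ}

theorem exists_pos_measure_lt_ne_zero {Z : Ω → ℝ} (hZ : MemLp Z 2 P) [IsProbabilityMeasure P]
    (hmean : ∫ ω, Z ω ∂P = 0) (hvar : 0 < variance Z P) : ∃ c > 0, P {ω | c < Z ω} ≠ 0 := by
  by_contra! h
  have hle : ∀ᵐ ω ∂P, 0 ≤ -Z ω := by
    have hall : ∀ᵐ ω ∂P, ∀ n : ℕ, Z ω ≤ 1 / ((n : ℝ) + 1) := by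
      rw [ae_all_iff]
      intro n
      have := h (1 / ((n : ℝ) + 1)) (by positivity)
      rw [ae_iff]
      simpa only [not_le] using this
    filter_upwards [hall] with ω hω
    have := ge_of_tendsto' tendsto_one_div_add_atTop_nhds_zero_nat hω
    linarith
  have hZi : Integrable (fun ω => -Z ω) P := (hZ.integrable one_le_two).neg
  have h0 : (fun ω => -Z ω) =ᵐ[P] 0 :=
    (integral_eq_zero_iff_of_nonneg_ae hle hZi).1 (by rw [integral_neg, hmean, neg_zero])
  have hZ0 : Z =ᵐ[P] 0 := by
    filter_upwards [h0] with ω hω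
    simpa using hω
  rw [variance_congr hZ0, variance_zero] at hvar
  exact lt_irrefl _ hvar

/-- From any state above `min r 0`, finitely many large innovations lead above any given level. -/
theorem exists_large_innovations {Z : Ω → ℝ} (hZ : MemLp Z 2 P) [IsProbabilityMeasure P]
    (hmean : ∫ ω, Z ω ∂P = 0) (hvar : 0 < variance Z P) (hα : 1 < α)
    (hH : r = 0 ∨ (r ≠ 0 ∧ ∀ x : ℝ, P {ω | Z ω ≤ x} < 1)) (M : ℝ) :
    ∃ (K : ℕ) (c : ℝ), P {ω | c < Z ω} ≠ 0 ∧ ∀ y e : ℕ → ℝ,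
      (∀ t, y (t + 1) = if r < y t then α * y t + e (t + 1) else β * y t + e (t + 1)) →
      min r 0 < y 0 → (∀ i < K, c < e (i + 1)) → M ≤ y K := by
  rcases hH with rfl | ⟨-, hH⟩
  · obtain ⟨c, hc, hPc⟩ := exists_pos_measure_lt_ne_zero hZ hmean hvar
    obtain ⟨K, hK⟩ := exists_nat_gt (M / c)
    refine ⟨K, c, hPc, fun y e hy h0 he => ?_⟩
    rw [min_self] at h0
    have key : ∀ i ≤ K, 0 < y i ∧ i * c ≤ y i := by
      intro i
      induction i with
      | zero => simpa using ⟨h0, h0.le⟩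
      | succ i ih =>
        intro hi
        obtain ⟨h1, h2⟩ := ih (by omega)
        have h3 := he i (by omega)
        rw [hy, if_pos h1]
        have h4 : y i ≤ α * y i := by nlinarith
        push_cast
        constructor <;> linarith
    exact ((div_lt_iff₀ hc).1 hK).le.trans (key K le_rfl).2
  · -- one step suffices: above `min r 0` the drift is at least `-(α + |β|) * |r|`
    refine ⟨1, M + (α + |β|) * |r|, ?_, fun y e hy h0 he => ?_⟩
    · intro h
      have h1 : {ω | Z ω ≤ M + (α + |β|) * |r|}ᶜ = {ω | M + (α + |β|) * |r| < Z ω} := by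
        ext; simp
      refine (hH (M + (α + |β|) * |r|)).ne ?_
      refine le_antisymm prob_le_one ?_
      have h2 := measure_univ_le_add_compl (μ := P) {ω | Z ω ≤ M + (α + |β|) * |r|}
      rwa [h1, h, add_zero, measure_univ] at h2
    · have h1 := he 0 one_pos
      rw [hy]
      have hr := neg_abs_le r
      have hr' := le_abs_self r
      have hβ := neg_abs_le β
      have hr0 := abs_nonneg r
      have hβ0 := abs_nonneg β
      split_ifs with h
      · nlinarith
      · -- the state lies in `(0, r]`, since `min r 0 = r` is excluded
        have hy0 : 0 < y 0 := by
          rcases min_lt_iff.1 h0 with h' | h'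
          · exact absurd h' h
          · exact h'
        have h5 : y 0 ≤ |r| := (not_lt.1 h).trans hr'
        have h6 : -|β| * |r| ≤ β * y 0 := by nlinarith
        nlinarith

theorem measurable_process (hX : ∀ n, Measurable (X n)) (hY0 : Y 0 = X 0)
    (hY : ∀ t ω, Y (t + 1) ω =
      if r < Y t ω then α * Y t ω + X (t + 1) ω else β * Y t ω + X (t + 1) ω) (n : ℕ) :
    Measurable[pastFiltration X hX n] (Y n) := by
  induction n with
  | zero => rw [hY0]; exact measurable_pastFiltration hX le_rfl
  | succ n ih =>
    have h1 : Measurable[pastFiltration X hX (n + 1)] (Y n) :=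
      ih.mono ((pastFiltration X hX).mono n.le_succ) le_rfl
    have h2 := measurable_pastFiltration hX (le_refl (n + 1))
    have h3 : Y (n + 1) = fun ω =>
      if r < Y n ω then α * Y n ω + X (n + 1) ω else β * Y n ω + X (n + 1) ω := funext (hY n)
    rw [h3]
    exact Measurable.ite (measurableSet_lt measurable_const h1) ((h1.const_mul α).add h2)
      ((h1.const_mul β).add h2)

/-- Below `min r 0` the process dominates a random walk, so that it cannot stay there. -/
theorem ae_frequently_min_lt [IsProbabilityMeasure P] (hX : ∀ n, Measurable (X n))
    (hind : iIndepFun X P) (hid : ∀ t, IdentDistrib (X (t + 1)) (X 1) P P)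
    (hsq : MemLp (X 1) 2 P) (hmean : ∫ ω, X 1 ω ∂P = 0) (hvar : 0 < variance (X 1) P)
    (hY : ∀ t ω, Y (t + 1) ω =
      if r < Y t ω then α * Y t ω + X (t + 1) ω else β * Y t ω + X (t + 1) ω) (hβ : β ≤ 1) :
    ∀ᵐ ω ∂P, ∃ᶠ n in atTop, min r 0 < Y n ω := by
  filter_upwards [ae_forall_exists_lt_sum hX hind hid hsq hmean hvar] with ω hω
  by_contra h
  rw [not_frequently, eventually_atTop] at h
  obtain ⟨N, hN⟩ := h
  have key : ∀ m, Y N ω + ∑ k ∈ Finset.range m, X (N + k + 1) ω ≤ Y (N + m) ω := by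
    intro m
    induction m with
    | zero => simp
    | succ m ih =>
      obtain ⟨h1, h2⟩ := le_min_iff.1 (not_lt.1 (hN (N + m) (by omega)))
      rw [← add_assoc, hY, if_neg (not_lt.2 h1), Finset.sum_range_succ]
      nlinarith
  obtain ⟨m, hm⟩ := hω N (min r 0 - Y N ω)
  have h1 := key m
  have h2 := not_lt.1 (hN (N + m) (by omega))
  linarith

theorem exists_measure_sum_le_ne_zero [IsProbabilityMeasure P]
    (hs : ∀ᵐ ω ∂P, Summable fun t : ℕ => |X (t + 1) ω| / α ^ (t + 1)) (hα : 1 < α) (B : ℝ) :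
    ∃ C ≥ B, P {ω | ∀ m, ∑ j ∈ Finset.range m, |X (j + 1) ω| / α ^ (j + 1) ≤ C} ≠ 0 := by
  by_contra! h
  have hnull : P (⋃ n : ℕ, {ω | ∀ m, ∑ j ∈ Finset.range m, |X (j + 1) ω| / α ^ (j + 1) ≤
      max B n}) = 0 := measure_iUnion_null fun n => h _ (le_max_left _ _)
  have hone : ∀ᵐ ω ∂P, ω ∈ ⋃ n : ℕ, {ω | ∀ m, ∑ j ∈ Finset.range m,
      |X (j + 1) ω| / α ^ (j + 1) ≤ max B n} := by
    filter_upwards [hs] with ω hω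
    obtain ⟨n, hn⟩ := exists_nat_ge (∑' t : ℕ, |X (t + 1) ω| / α ^ (t + 1))
    refine Set.mem_iUnion.2 ⟨n, fun m => le_trans ?_ (hn.trans (le_max_right _ _))⟩
    exact hω.sum_le_tsum _ fun t _ => by positivity
  obtain ⟨ω, h1, h2⟩ := (hone.and (measure_eq_zero_iff_ae_notMem.1 hnull)).exists
  exact h2 h1

/-- The process almost surely enters a stretch of geometric growth that never ends. -/
theorem ae_exists_pow_mul_le [IsProbabilityMeasure P] (hX : ∀ n, Measurable (X n))
    (hind : iIndepFun X P) (hid : ∀ t, IdentDistrib (X (t + 1)) (X 1) P P)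
    (hsq : MemLp (X 1) 2 P) (hmean : ∫ ω, X 1 ω ∂P = 0) (hvar : 0 < variance (X 1) P)
    (hY0 : Y 0 = X 0)
    (hY : ∀ t ω, Y (t + 1) ω =
      if r < Y t ω then α * Y t ω + X (t + 1) ω else β * Y t ω + X (t + 1) ω)
    (hα : 1 < α) (hβ : β ≤ 1) (hH : r = 0 ∨ (r ≠ 0 ∧ ∀ x : ℝ, P {ω | X 1 ω ≤ x} < 1)) :
    ∃ D > 0, r < D ∧ ∀ᵐ ω ∂P, ∃ N, ∀ m, α ^ m * D ≤ Y (N + m) ω := by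
  have hs := ae_summable_abs_div_pow hid (hsq.integrable one_le_two) hα
  obtain ⟨D, hDr, hD⟩ := exists_measure_sum_le_ne_zero hs hα (|r| + 1)
  have hD0 : 0 < D := by linarith [abs_nonneg r]
  have hrD : r < D := by linarith [le_abs_self r]
  obtain ⟨K, c, hc, hK⟩ := exists_large_innovations (α := α) (β := β) hsq hmean hvar hα hH (2 * D)
  refine ⟨D, hD0, hrD, ?_⟩
  -- a trial: `K` innovations above `c`, then innovations with absolute discounted sum at most `D`
  set Γ₁ : Set (ℕ → ℝ) := {x | ∀ i ∈ Finset.range K, c < x i} with hΓ₁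
  set Γ₂ : Set (ℕ → ℝ) := {x | ∀ m, ∑ j ∈ Finset.range m, |x j| / α ^ (j + 1) ≤ D} with hΓ₂
  have hΓ₁m : MeasurableSet Γ₁ := by
    rw [hΓ₁]
    simp only [Set.ofPred_forall]
    exact Finset.measurableSet_biInter _ fun i _ =>
      measurableSet_lt measurable_const (measurable_pi_apply i)
  have hΓ₂m : MeasurableSet Γ₂ := by
    rw [hΓ₂, Set.ofPred_forall]
    exact MeasurableSet.iInter fun m => measurableSet_le (by fun_prop) measurable_const
  set Γ : Set (ℕ → ℝ) := Γ₁ ∩ (fun x t => x (K + t)) ⁻¹' Γ₂ with hΓ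
  have hΓm : MeasurableSet Γ := hΓ₁m.inter
    ((measurable_pi_lambda _ fun t => measurable_pi_apply (K + t)) hΓ₂m)
  have hpos : P {ω | (fun t => X (t + 1) ω) ∈ Γ} ≠ 0 := by
    have h1 : P {ω | (fun t => X (t + 1) ω) ∈ Γ₁} ≠ 0 := by
      have hpre : {ω | (fun t => X (t + 1) ω) ∈ Γ₁} =
          ⋂ i ∈ Finset.range K, (fun ω => X (i + 1) ω) ⁻¹' Set.Ioi c := by
        ext ω
        simp [hΓ₁]
      rw [hpre, (hind.precomp (g := fun t => t + 1) fun a b h => by simpa using h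
        ).measure_inter_preimage_eq_mul _ (sets := fun _ => Set.Ioi c)
        fun _ _ => measurableSet_Ioi]
      refine Finset.prod_ne_zero_iff.2 fun i _ => ?_
      have := (hid i).measure_mem_eq (measurableSet_Ioi (a := c))
      rw [this]
      exact hc
    have h2 : P {ω | (fun t => X (K + t + 1) ω) ∈ Γ₂} ≠ 0 := by
      have := (identDistrib_shift hind hid K).measure_mem_eq hΓ₂m
      exact fun h => hD (this.symm.trans h)
    have h3 : MeasurableSet[pastFiltration X hX K] {ω | (fun t => X (t + 1) ω) ∈ Γ₁} := by
      have hpre : {ω | (fun t => X (t + 1) ω) ∈ Γ₁} =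
          ⋂ i ∈ Finset.range K, {ω | c < X (i + 1) ω} := by
        ext ω
        simp [hΓ₁]
      rw [hpre]
      exact Finset.measurableSet_biInter _ fun i hi => measurableSet_lt measurable_const
        (measurable_pastFiltration hX (Finset.mem_range.1 hi))
    have h4 := (Indep_iff _ _ _).1 (indep_future_past hX hind K) _ _
      (measurable_shift_futureSigma K hΓ₂m) h3
    have hpre : {ω | (fun t => X (t + 1) ω) ∈ Γ} = (fun ω (t : ℕ) => X (K + t + 1) ω) ⁻¹' Γ₂ ∩
        {ω | (fun t => X (t + 1) ω) ∈ Γ₁} := by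
      rw [Set.inter_comm]
      rfl
    rw [hpre, h4]
    exact mul_ne_zero h2 h1
  have hle : ∀ n, Measurable[⨆ n, pastFiltration X hX n] (Y n) := fun n =>
    (measurable_process hX hY0 hY n).mono
      (le_iSup (fun n => (pastFiltration X hX n : MeasurableSpace Ω)) n) le_rfl
  have h := ae_mem_of_frequently_of_shift hX hind hid hΓm hpos
    (A := {ω | ∃ N, ∀ m, α ^ m * D ≤ Y (N + m) ω}) (E := fun n => {ω | min r 0 < Y n ω}) ?_
    (fun n => measurableSet_lt measurable_const (measurable_process hX hY0 hY n)) ?_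
  · filter_upwards [h, ae_frequently_min_lt hX hind hid hsq hmean hvar hY hβ] with ω h1 h2
    exact h1 h2
  · rw [Set.ofPred_exists]
    refine MeasurableSet.iUnion fun N => ?_
    rw [Set.ofPred_forall]
    exact MeasurableSet.iInter fun m => measurableSet_le measurable_const (hle _)
  · rintro n ω hω ⟨h1, h2⟩
    refine ⟨n + K, fun m => ?_⟩
    have hM : 2 * D ≤ Y (n + K) ω := hK (fun t => Y (n + t) ω) (fun t => X (n + t) ω)
      (fun t => hY (n + t) ω) hω fun i hi => h1 i (Finset.mem_range.2 hi)
    have := pow_mul_half_le_of_sum_le (y := fun t => Y t ω) (e := fun t => X t ω) (M := 2 * D)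
      hα (fun t => hY t ω) (by linarith) (by linarith) hM (fun m => ?_) m
    · simpa using this
    · have := h2 m
      simp only [← add_assoc] at this
      linarith

end Escape

/-! ### Joint convergence in distribution -/

section WeakLimit
variable {Ω : Type*} {mΩ : MeasurableSpace Ω} {P : Measure Ω} {X Y : ℕ → Ω → ℝ} {α β r : ℝ}

/-- Independent innovations stay independent when the independent initial value is put in the
unused position `0`. -/
theorem iIndepFun_update_zero [IsProbabilityMeasure P] {ε : ℕ → Ω → ℝ} {Z : Ω → ℝ}
    (hind : iIndepFun (fun t : ℕ => ε (t + 1)) P)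
    (hZ : IndepFun Z (fun ω (t : ℕ) => ε (t + 1) ω) P) :
    iIndepFun (Function.update ε 0 Z) P := by
  rw [iIndepFun_iff_measure_inter_preimage_eq_mul] at hind ⊢
  have hsucc : ∀ (T : Finset ℕ) (A : ℕ → Set ℝ), (∀ i ∈ T, MeasurableSet (A (i + 1))) →
      P (⋂ i ∈ T, ε (i + 1) ⁻¹' A (i + 1)) = ∏ i ∈ T, P (ε (i + 1) ⁻¹' A (i + 1)) :=
    fun T A hA => hind T (sets := fun i => A (i + 1)) hA
  intro S A hA
  obtain ⟨T, hT⟩ : ∃ T : Finset ℕ, S.erase 0 = T.map (addRightEmbedding 1) := by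
    refine ⟨(S.erase 0).image Nat.pred, ?_⟩
    ext i
    simp only [Finset.mem_map, Finset.mem_image, addRightEmbedding_apply,
      exists_exists_and_eq_and]
    constructor
    · intro hi
      exact ⟨i, hi, Nat.succ_pred (Finset.ne_of_mem_erase hi)⟩
    · rintro ⟨j, hj, rfl⟩
      rwa [← Nat.succ_eq_add_one, Nat.succ_pred (Finset.ne_of_mem_erase hj)]
  have hTA : ∀ i ∈ T, MeasurableSet (A (i + 1)) := fun i hi =>
    hA _ (Finset.mem_of_mem_erase (a := 0) (by rw [hT]; simpa using hi))
  by_cases h0 : 0 ∈ S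
  · have hS : S = insert 0 (T.map (addRightEmbedding 1)) := by rw [← hT, Finset.insert_erase h0]
    have h0' : 0 ∉ T.map (addRightEmbedding 1) := by simp
    rw [hS, Finset.set_biInter_insert, Finset.prod_insert h0', Finset.prod_map]
    have hinter : ⋂ i ∈ T.map (addRightEmbedding 1), Function.update ε 0 Z i ⁻¹' A i =
        ⋂ i ∈ T, ε (i + 1) ⁻¹' A (i + 1) := by
      ext ω; simp
    have hpre : ⋂ i ∈ T, ε (i + 1) ⁻¹' A (i + 1) = (fun ω (t : ℕ) => ε (t + 1) ω) ⁻¹'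
        ⋂ i ∈ T, (fun x : ℕ → ℝ => x i) ⁻¹' A (i + 1) := by
      ext ω; simp
    rw [hinter]
    simp only [Function.update_self, addRightEmbedding_apply, ne_eq, Nat.add_eq_zero_iff,
      one_ne_zero, and_false, not_false_eq_true, Function.update_of_ne]
    rw [← hsucc T A hTA, hpre]
    exact hZ.measure_inter_preimage_eq_mul _ _ (hA 0 h0)
      (Finset.measurableSet_biInter _ fun i hi => measurable_pi_apply i (hTA i hi))
  · have hS : S = T.map (addRightEmbedding 1) := by rw [← hT, Finset.erase_eq_of_notMem h0]
    rw [hS, Finset.prod_map]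
    have hinter : ⋂ i ∈ T.map (addRightEmbedding 1), Function.update ε 0 Z i ⁻¹' A i =
        ⋂ i ∈ T, ε (i + 1) ⁻¹' A (i + 1) := by
      ext ω; simp
    rw [hinter, hsucc T A hTA]
    simp

/-- Convergence in distribution depends only on the laws involved. -/
theorem tendstoInDistribution_of_identDistrib_of_identDistrib {Ω₁ Ω₂ Ω₃ Ω₄ E : Type*}
    [MeasurableSpace Ω₁] [MeasurableSpace Ω₂] [MeasurableSpace Ω₃] [MeasurableSpace Ω₄]
    [TopologicalSpace E] [MeasurableSpace E] [OpensMeasurableSpace E]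
    {μ₁ : Measure Ω₁} {μ₂ : Measure Ω₂} {μ₃ : Measure Ω₃} {μ₄ : Measure Ω₄}
    [IsProbabilityMeasure μ₁] [IsProbabilityMeasure μ₂] [IsProbabilityMeasure μ₃]
    [IsProbabilityMeasure μ₄] {ι : Type*} {l : Filter ι} {A : ι → Ω₁ → E} {Z : Ω₂ → E}
    {B : ι → Ω₃ → E} {W : Ω₄ → E} (h : TendstoInDistribution A l Z (fun _ => μ₁) μ₂)
    (hAB : ∀ i, IdentDistrib (A i) (B i) μ₁ μ₃) (hZW : IdentDistrib Z W μ₂ μ₄) :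
    TendstoInDistribution B l W (fun _ => μ₃) μ₄ where
  forall_aemeasurable i := (hAB i).aemeasurable_snd
  aemeasurable_limit := hZW.aemeasurable_snd
  tendsto := by
    have := h.tendsto
    simp only [(hAB _).map_eq, hZW.map_eq] at this
    exact this

/-- Reversing the order of the innovations does not change the law of their discounted sum. -/
theorem identDistrib_sum_reversed (hind : iIndepFun X P)
    (hid : ∀ t, IdentDistrib (X (t + 1)) (X 1) P P) (k n : ℕ) :
    IdentDistrib (fun ω => ∑ t ∈ Finset.Ico k n, X (t + 1) ω / α ^ (n - t))
      (fun ω => ∑ i ∈ Finset.range (n - k), X (i + 1) ω / α ^ (i + 1)) P P := by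
  have hpi := IdentDistrib.pi (ι := Fin (n - k)) (μ := P) (ν := P)
    (X := fun i => X (n - 1 - i + 1)) (Y := fun i => X (i + 1))
    (fun i => (hid _).trans (hid i).symm)
    (hind.precomp (g := fun i : Fin (n - k) => n - 1 - i + 1) fun a b h => by
      have ha := a.2
      have hb := b.2
      ext
      simp only at h
      omega)
    (hind.precomp (g := fun i : Fin (n - k) => (i : ℕ) + 1) fun a b h => by
      ext
      simpa using h)
  have h := hpi.comp (u := fun x : Fin (n - k) → ℝ => ∑ i, x i / α ^ ((i : ℕ) + 1))
    (by fun_prop)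
  convert! h using 2 with ω ω
  · simp only [Function.comp_apply]
    rw [Fin.sum_univ_eq_sum_range (fun i => X (n - 1 - i + 1) ω / α ^ (i + 1)) (n - k)]
    refine Finset.sum_bij' (fun t _ => n - 1 - t) (fun i _ => n - 1 - i) ?_ ?_ ?_ ?_ ?_
    · intro t ht; simp only [Finset.mem_range, Finset.mem_Ico] at *; omega
    · intro i hi; simp only [Finset.mem_range, Finset.mem_Ico] at *; omega
    · intro t ht; simp only [Finset.mem_Ico] at *; omega
    · intro i hi; simp only [Finset.mem_range] at *; omega
    · intro t ht
      simp only [Finset.mem_Ico] at ht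
      rw [Nat.sub_sub_self (by omega), show n - t = n - 1 - t + 1 by omega]
  · simp only [Function.comp_apply]
    rw [Fin.sum_univ_eq_sum_range (fun i => X (i + 1) ω / α ^ (i + 1)) (n - k)]

/-- Asymptotic independence: the reversed discounted sum over the innovations after time `n / 3`
is independent of the path up to time `n / 3`, so that the two converge jointly to independent
limits. -/
theorem tendstoInDistribution_prodMk_reversed [IsProbabilityMeasure P]
    (hX : ∀ n, Measurable (X n)) (hind : iIndepFun X P)
    (hid : ∀ t, IdentDistrib (X (t + 1)) (X 1) P P)
    {V : ℕ → Ω → ℝ} (hV : ∀ n, Measurable[pastFiltration X hX n] (V n)) {ζ η : Ω → ℝ}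
    (hζm : AEMeasurable ζ P) (hζ : ∀ᵐ ω ∂P, Tendsto (fun n => V n ω) atTop (𝓝 (ζ ω)))
    (hηm : AEMeasurable η P) (hη : ∀ᵐ ω ∂P, Tendsto
      (fun n => ∑ i ∈ Finset.range n, X (i + 1) ω / α ^ (i + 1)) atTop (𝓝 (η ω)))
    {Ω' : Type*} [MeasurableSpace Ω'] {P' : Measure Ω'} [IsProbabilityMeasure P']
    {ηs ζs : Ω' → ℝ} (hs : IndepFun ηs ζs P') (hηs : IdentDistrib ηs η P' P)
    (hζs : IdentDistrib ζs ζ P' P) :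
    TendstoInDistribution
      (fun (n : ℕ) ω => (∑ t ∈ Finset.Ico (n / 3) n, X (t + 1) ω / α ^ (n - t), V (n / 3) ω))
      atTop (fun ω' => (ηs ω', ζs ω')) (fun _ => P) P' := by
  have hVm : ∀ n, Measurable (V n) := fun n => (hV n).mono ((pastFiltration X hX).le n) le_rfl
  have hSm : ∀ n, Measurable fun ω => ∑ i ∈ Finset.range n, X (i + 1) ω / α ^ (i + 1) :=
    fun n => by fun_prop
  have hdiv : Tendsto (fun n : ℕ => n / 3) atTop atTop :=
    Nat.tendsto_div_const_atTop (by norm_num)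
  have hsub : Tendsto (fun n : ℕ => n - n / 3) atTop atTop :=
    tendsto_atTop_mono (fun n => by omega) hdiv
  have hfst : ∀ {Z : Ω → ℝ}, AEMeasurable Z P →
      IdentDistrib (fun p : Ω × Ω => Z p.1) Z (P.prod P) P := fun {Z} h =>
    (IdentDistrib.mk (f := Prod.fst) (g := id) measurable_fst.aemeasurable aemeasurable_id
      (by simp)).comp_of_aemeasurable (u := Z) (by simpa using h)
  have hsnd : ∀ {Z : Ω → ℝ}, AEMeasurable Z P →
      IdentDistrib (fun p : Ω × Ω => Z p.2) Z (P.prod P) P := fun {Z} h =>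
    (IdentDistrib.mk (f := Prod.snd) (g := id) measurable_snd.aemeasurable aemeasurable_id
      (by simp)).comp_of_aemeasurable (u := Z) (by simpa using h)
  -- on the product space the independent copies converge almost surely
  have hprod : TendstoInDistribution (fun (n : ℕ) (p : Ω × Ω) =>
      (∑ i ∈ Finset.range (n - n / 3), X (i + 1) p.1 / α ^ (i + 1), V (n / 3) p.2)) atTop
      (fun p => (η p.1, ζ p.2)) (fun _ => P.prod P) (P.prod P) := by
    refine tendstoInDistribution_of_ae_tendsto (fun n => ?_) ?_ ?_
    · exact (((hSm _).comp measurable_fst).prodMk ((hVm _).comp measurable_snd)).aemeasurable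
    · exact (hηm.comp_quasiMeasurePreserving Measure.quasiMeasurePreserving_fst).prodMk
        (hζm.comp_quasiMeasurePreserving Measure.quasiMeasurePreserving_snd)
    · filter_upwards [Measure.quasiMeasurePreserving_fst.ae hη,
        Measure.quasiMeasurePreserving_snd.ae hζ] with p h1 h2
      exact (h1.comp hsub).prodMk_nhds (h2.comp hdiv)
  refine tendstoInDistribution_of_identDistrib_of_identDistrib hprod (fun n => ?_) ?_
  · refine IdentDistrib.prodMk 
      ((hfst (hSm _).aemeasurable).trans (identDistrib_sum_reversed hind hid (n / 3) n).symm)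
      (hsnd (hVm _).aemeasurable) (indepFun_prod (hSm _) (hVm _)) ?_
    rw [IndepFun_iff_Indep]
    refine indep_of_indep_of_le_left (indep_of_indep_of_le_right
      (indep_future_past hX hind (n / 3)) (hV (n / 3)).comap_le) (Measurable.comap_le ?_)
    exact Finset.measurable_fun_sum _ fun t ht => (measurable_futureSigma
      (by have := (Finset.mem_Ico.1 ht).1; omega)).div_const _
  · exact IdentDistrib.prodMk ((hfst hηm).trans hηs.symm)
      ((hsnd hζm).trans hζs.symm) (indepFun_prod₀ hηm hζm) hs

end WeakLimit

/-! ### The limit theorem -/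

theorem theorem2p2 {Ω : Type*} [MeasurableSpace Ω] (P : Measure Ω) [IsProbabilityMeasure P]
    (α β r : ℝ) (Y ε : ℕ → Ω → ℝ)
    -- the innovations `ε 1, ε 2, …` are i.i.d. with mean zero and finite positive variance
    (hε_meas : ∀ t : ℕ, Measurable (ε (t + 1)))
    (hε_indep : iIndepFun (fun t : ℕ => ε (t + 1)) P)
    (hε_ident : ∀ t : ℕ, IdentDistrib (ε (t + 1)) (ε 1) P P)
    (hε_sq : MemLp (ε 1) 2 P)
    (hε_mean : ∫ ω, ε 1 ω ∂P = 0)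
    (hε_var : 0 < variance (ε 1) P)
    -- the initial value is a random variable independent of the innovations
    (hY0_meas : Measurable (Y 0))
    (hY0_indep : IndepFun (Y 0) (fun ω (t : ℕ) => ε (t + 1) ω) P)
    (hY0_sq : MemLp (Y 0) 2 P)
    (hY : IsTAR 0 0 α β r Y ε)
    (hα : 1 < α) (hβ : β ≤ 1)
    (hH : r = 0 ∨ (r ≠ 0 ∧ ∀ x : ℝ, P {ω | ε 1 ω ≤ x} < 1)) :
    -- `ξ` is well defined, almost surely positive, and the almost sure limit of `Y n / α ^ n`
    (∀ᵐ ω ∂P, ∀ k : ℕ, {t : ℕ | k ≤ t ∧ Y t ω ≤ r}.Finite) ∧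
    (∀ᵐ ω ∂P, Summable (fun k : ℕ => xiTerm α β r Y ε (k + 1) ω)) ∧
    AEMeasurable (xi α β r Y ε) P ∧
    (∀ᵐ ω ∂P, 0 < xi α β r Y ε ω) ∧
    (∀ᵐ ω ∂P, Tendsto (fun n : ℕ => Y n ω / α ^ n) atTop (𝓝 (xi α β r Y ε ω))) ∧
    -- the series `∑ α ^ (-t) ε_t` converges almost surely
    (∀ᵐ ω ∂P, Summable (fun t : ℕ => ε (t + 1) ω / α ^ (t + 1))) ∧
    AEMeasurable (eta α ε) P ∧
    -- the normalized estimation error converges in distribution to `η* / ξ*`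
    (∀ {Ω' : Type*} [MeasurableSpace Ω'] (P' : Measure Ω') [IsProbabilityMeasure P']
      (ηs ξs : Ω' → ℝ),
      IndepFun ηs ξs P' →
      IdentDistrib ηs (eta α ε) P' P →
      IdentDistrib ξs (xi α β r Y ε) P' P →
      TendstoInDistribution
        (fun (n : ℕ) (ω : Ω) => (α ^ 2 - 1)⁻¹ * α ^ n * (lseAlpha 0 r Y n ω - α)) atTop
        (fun ω' => ηs ω' / ξs ω') (fun _ => P) P') := by
  -- the initial value takes the unused place of `ε 0`
  set X : ℕ → Ω → ℝ := Function.update ε 0 (Y 0) with hXdef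
  have hX0 : Y 0 = X 0 := by simp [hXdef]
  have hXs : ∀ t, X (t + 1) = ε (t + 1) := fun t => by simp [hXdef]
  have hX1 : X 1 = ε 1 := hXs 0
  have hX : ∀ n, Measurable (X n)
    | 0 => hX0 ▸ hY0_meas
    | t + 1 => by rw [hXs]; exact hε_meas t
  have hind : iIndepFun X P := iIndepFun_update_zero hε_indep hY0_indep
  have hid : ∀ t, IdentDistrib (X (t + 1)) (X 1) P P := fun t => by
    rw [hXs, hX1]
    exact hε_ident t
  have hYε : ∀ t ω, Y (t + 1) ω =
      if r < Y t ω then α * Y t ω + ε (t + 1) ω else β * Y t ω + ε (t + 1) ω := fun t ω => by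
    simpa using hY t ω
  have hYX : ∀ t ω, Y (t + 1) ω =
      if r < Y t ω then α * Y t ω + X (t + 1) ω else β * Y t ω + X (t + 1) ω := fun t ω => by
    rw [hXs]
    exact hYε t ω
  have hYm : ∀ n, Measurable (Y n) := fun n =>
    (measurable_process hX hX0 hYX n).mono ((pastFiltration X hX).le n) le_rfl
  have hα0 : 0 < α := by positivity
  have hint : Integrable (ε 1) P := hε_sq.integrable one_le_two
  have habs := ae_summable_abs_div_pow hε_ident hint hα
  have habs' := ae_summable_abs_div_pow hε_ident hint (ρ := √α)
    (Real.lt_sqrt_of_sq_lt (by simpa using hα))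
  have hsum : ∀ᵐ ω ∂P, Summable fun t : ℕ => ε (t + 1) ω / α ^ (t + 1) := by
    filter_upwards [habs] with ω hω
    refine Summable.of_norm (hω.congr fun t => ?_)
    rw [norm_div, norm_pow, Real.norm_eq_abs, Real.norm_eq_abs, abs_of_pos hα0]
  obtain ⟨D, hD0, hDr, hgrow⟩ := ae_exists_pow_mul_le (α := α) (β := β) (r := r) hX hind hid
    (hX1 ▸ hε_sq) (hX1 ▸ hε_mean) (hX1 ▸ hε_var) hX0 hYX hα hβ (hX1 ▸ hH)
  have hup : ∀ᵐ ω ∂P, ∃ N, ∀ t, N ≤ t → r < Y t ω := by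
    filter_upwards [hgrow] with ω ⟨N, hN⟩
    refine ⟨N, fun t ht => ?_⟩
    obtain ⟨m, rfl⟩ := Nat.exists_eq_add_of_le ht
    refine hDr.trans_le (le_trans ?_ (hN m))
    exact le_mul_of_one_le_left hD0.le (one_le_pow₀ hα.le)
  have hlim : ∀ᵐ ω ∂P, Tendsto (fun n : ℕ => Y n ω / α ^ n) atTop (𝓝 (xi α β r Y ε ω)) := by
    filter_upwards [hup, hsum] with ω ⟨N, hN⟩ hs
    exact tendsto_div_pow_xi hα (fun t => hYε t ω) hN hs
  have hxim : AEMeasurable (xi α β r Y ε) P :=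
    aemeasurable_of_tendsto_metrizable_ae atTop
      (fun n => ((hYm n).div_const (α ^ n)).aemeasurable) hlim
  have hxipos : ∀ᵐ ω ∂P, 0 < xi α β r Y ε ω := by
    filter_upwards [hgrow, hlim] with ω ⟨N, hN⟩ hω
    refine lt_of_lt_of_le (by positivity : 0 < D / α ^ N) (ge_of_tendsto hω ?_)
    filter_upwards [eventually_ge_atTop N] with t ht
    obtain ⟨m, rfl⟩ := Nat.exists_eq_add_of_le ht
    rw [pow_add, div_le_div_iff₀ (by positivity) (by positivity)]
    calc D * (α ^ N * α ^ m) = α ^ m * D * α ^ N := by ring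
      _ ≤ Y (N + m) ω * α ^ N := by gcongr; exact hN m
  have hetalim : ∀ᵐ ω ∂P, Tendsto
      (fun n => ∑ i ∈ Finset.range n, ε (i + 1) ω / α ^ (i + 1)) atTop (𝓝 (eta α ε ω)) := by
    filter_upwards [hsum] with ω hω
    exact hω.hasSum.tendsto_sum_nat
  have hetam : AEMeasurable (eta α ε) P :=
    aemeasurable_of_tendsto_metrizable_ae atTop (fun n => (Finset.measurable_fun_sum _
      fun i _ => (hε_meas i).div_const _).aemeasurable) hetalim
  refine ⟨?_, ?_, hxim, hxipos, hlim, hsum, hetam, ?_⟩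
  · filter_upwards [hup] with ω ⟨N, hN⟩ k
    exact finite_lower_visits hN k
  · filter_upwards [hup, hsum] with ω ⟨N, hN⟩ hs
    exact summable_xiTerm hN hs
  intro Ω' _ P' _ ηs ξs hindep hηs hξs
  have hVm : ∀ n, Measurable[pastFiltration X hX n] fun ω => (Y n ω / α ^ n)⁻¹ := fun n =>
    ((measurable_process hX hX0 hYX n).div_const _).inv
  have hVlim : ∀ᵐ ω ∂P, Tendsto (fun n : ℕ => (Y n ω / α ^ n)⁻¹) atTop
      (𝓝 (xi α β r Y ε ω)⁻¹) := by
    filter_upwards [hlim, hxipos] with ω h1 h2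
    exact h1.inv₀ h2.ne'
  have hpair := tendstoInDistribution_prodMk_reversed (α := α) hX hind hid hVm hxim.inv hVlim
    hetam (by simpa only [hXs] using hetalim) (hindep.comp measurable_id measurable_inv) hηs
    (hξs.comp measurable_inv)
  simp only [hXs] at hpair
  have hdiv : Tendsto (fun n : ℕ => n / 3) atTop atTop :=
    Nat.tendsto_div_const_atTop (by norm_num)
  set U : ℕ → Ω → ℝ := fun n ω => ∑ t ∈ Finset.Ico (n / 3) n, ε (t + 1) ω / α ^ (n - t) with hU
  set F : ℕ → Ω → ℝ := fun n ω => errorFactor α r (xi α β r Y ε ω) Y n ω with hF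
  set T : ℕ → Ω → ℝ :=
    fun n ω => (α ^ 2 - 1)⁻¹ * α ^ n * (lseAlpha 0 r Y n ω - α) with hT
  have hite : ∀ (t : ℕ) (g : Ω → ℝ), Measurable g →
      Measurable fun ω => if r < Y t ω then g ω else 0 := fun t g hg =>
    Measurable.ite (measurableSet_lt measurable_const (hYm t)) hg measurable_const
  have hUm : ∀ n, Measurable (U n) := fun n =>
    Finset.measurable_fun_sum _ fun t _ => (hε_meas t).div_const _
  have hSqm : ∀ n : ℕ, Measurable fun ω =>
      ∑ t ∈ Finset.Ico 1 n, if r < Y t ω then Y t ω ^ 2 else 0 := fun n =>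
    Finset.measurable_fun_sum _ fun t _ => hite t _ ((hYm t).pow_const 2)
  have hFm : ∀ n, AEMeasurable (F n) P := fun n =>
    hxim.div (((hSqm n).div_const _).const_mul _).aemeasurable
  have hTm : ∀ n, Measurable (T n) := fun n =>
    (((Finset.measurable_fun_sum _ fun t _ => hite t _
      ((hYm t).mul ((hYm (t + 1)).sub_const 0))).div (hSqm n)).sub_const α).const_mul _
  -- `(Y k / α ^ k)⁻¹` and `errorFactor` both tend to `1 / ξ`, so the pair may use the latter
  have hpair' : TendstoInDistribution (fun n ω => (U n ω, F n ω)) atTop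
      (fun ω' => (ηs ω', (ξs ω')⁻¹)) (fun _ => P) P' := by
    refine tendstoInDistribution_of_tendstoInMeasure_sub _ _ hpair
      (tendstoInMeasure_of_tendsto_ae (fun n => ?_) ?_) fun n => (hUm n).aemeasurable.prodMk (hFm n)
    · exact (((hUm n).aemeasurable.prodMk (hFm n)).sub
        (hpair.forall_aemeasurable n)).aestronglyMeasurable
    · filter_upwards [hup, hxipos, hlim, hVlim] with ω ⟨N, hN⟩ h1 h2 h3
      have h4 := (tendsto_errorFactor hα hN h1 h2).sub (h3.comp hdiv)
      rw [sub_self] at h4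
      have h5 := (tendsto_const_nhds (x := (0 : ℝ)) (f := atTop (α := ℕ))).prodMk_nhds h4
      refine h5.congr fun n => ?_
      simp [hU, hF]
  have hprod := hpair'.continuous_comp (g := fun p : ℝ × ℝ => p.1 * p.2) (by fun_prop)
  refine tendstoInDistribution_of_tendstoInMeasure_sub _ _ hprod
    (tendstoInMeasure_of_tendsto_ae (fun n => ?_) ?_) fun n => (hTm n).aemeasurable
  · exact ((hTm n).aemeasurable.sub (hprod.forall_aemeasurable n)).aestronglyMeasurable
  · filter_upwards [hup, hxipos, hlim, habs, habs'] with ω ⟨N, hN⟩ h1 h2 h3 h4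
    refine (tendsto_normalized_error_sub hα (fun t ht => ?_) hN h1 h2 h4 h3).congr fun n => ?_
    · rw [hYε, if_pos ht]
    · rfl
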